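/- Let $G$ be a discrete group and $L:G\to[0,\infty)$ a length function, i.e. $L(1)=0$, $L(g^{-1})=L(g)$ and $L(gh)\le L(g)+L(h)$ for all $g,h\in G$. Let $\lambda$ be the left regular representation of $G$ on $\ell^2(G)$, and let $C^*_r(G)\subset B(\ell^2(G))$ be the closed unital $*$-subalgebra generated by $\{\lambda_g : g\in G\}$. Assume that $G$ is an RD-group (rapid decay) for $L$: every function $\xi:G\to\mathbb C$ with $\sum_{g\in G}|\xi(g)|^2(1+L(g))^{2s}<\infty$ for all $s\in\mathbb R$ belongs to $C^*_r(G)$, where $C^*_r(G)$ is regarded as a subset of $\ell^2(G)$ through the injection $a\mapsto a\delta_1$. Let $\beta$ be an automorphism of $G$ such that $L(\beta(g))=L(g)$ for all $g\in G$ and such that every orbit $\{\beta^k(g):k\in\mathbb Z\}$ is infinite or a singleton. Let $\alpha$ be the automorphism of $C^*_r(G)$ induced by $\beta$, i.e. $\alpha(\lambda_g)=\lambda_{\beta(g)}$, let $H=\{g\in G:\beta(g)=g\}$, and let $C^*_r(H)\subset C^*_r(G)$ be the closed unital $*$-subalgebra generated by $\{\lambda_h:h\in H\}$. Then $C^*_r(H)$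 is the fixed-point algebra $\{x\in C^*_r(G):\alpha(x)=x\}$, the norm limit $$E(x)=\lim_{n\to\infty}\frac1n\sum_{k=0}^{n-1}\alpha^k(x)$$ exists for every $x\in C^*_r(G)$ and defines a conditional expectation $E$ (a projection of norm one) of $C^*_r(G)$ onto $C^*_r(H)$, and $\alpha$ is $E$-strictly weak mixing: for every state $\varphi$ of $C^*_r(G)$ and every $x\in C^*_r(G)$, $$\lim_{n\to\infty}\frac1n\sum_{k=0}^{n-1}\bigl|\varphi(\alpha^k(x))-\varphi(E(x))\bigr|=0 .$$ -/

import Mathlib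

open Filter Topology
open scoped lp ENNReal ComplexOrder

noncomputable section

/-! ### Strict weak mixing of a linear map on a unital C*-algebra -/

section Mixing

variable {A : Type*} [CStarAlgebra A]

/-- A state of `A`: a positive linear functional of norm one. -/
def IsState (φ : A →L[ℂ] ℂ) : Prop :=
  (∀ a : A, 0 ≤ φ (star a * a)) ∧ ‖φ‖ = 1

/-- `T` is `F`-strictly weak mixing:
`(1/n) ∑_{k<n} |φ (T^k x) - φ (F x)| → 0` for every state `φ` and every `x`. -/
def IsStrictlyWeakMixing (T F : A →ₗ[ℂ] A) : Prop :=
  ∀ φ : A →L[ℂ] ℂ, IsState φ → ∀ x : A,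
    Tendsto (fun n : ℕ => (n : ℝ)⁻¹ * ∑ k ∈ Finset.range n, ‖φ ((T ^ k) x) - φ (F x)‖)
      atTop (𝓝 0)

/-- `E` is a conditional expectation of `A` onto the unital C*-subalgebra `B`:
a projection of norm one of `A` onto `B`. -/
structure IsCondExpOnto (E : A →L[ℂ] A) (B : StarSubalgebra ℂ A) : Prop where
  isClosed : IsClosed (B : Set A)
  mem : ∀ x, E x ∈ B
  eq_self : ∀ b ∈ B, E b = b
  norm_eq_one : ‖E‖ = 1

end Mixing

/-! ### The reduced group C*-algebra -/

/-- The Hilbert space `ℓ²(G)`. -/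
abbrev EllTwo (G : Type*) : Type _ := lp (fun _ : G => ℂ) 2

/-- The unitary operator `(U_e ξ)(h) = ξ (e⁻¹ h)` of `ℓ²(G)`, for a permutation `e` of `G`. -/
def permIsometry {G : Type*} (e : Equiv.Perm G) : EllTwo G ≃ₗᵢ[ℂ] EllTwo G where
  toFun ξ := ⟨fun h => ξ (e.symm h), by
    have h2 : 0 < (2 : ℝ≥0∞).toReal := by norm_num
    have := (memℓp_gen_iff h2).1 (lp.memℓp ξ)
    exact (memℓp_gen_iff h2).2 (e.symm.summable_iff.2 this)⟩
  invFun ξ := ⟨fun h => ξ (e h), by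
    have h2 : 0 < (2 : ℝ≥0∞).toReal := by norm_num
    have := (memℓp_gen_iff h2).1 (lp.memℓp ξ)
    exact (memℓp_gen_iff h2).2 (e.summable_iff.2 this)⟩
  map_add' _ _ := rfl
  map_smul' _ _ := rfl
  left_inv ξ := by ext h; simp
  right_inv ξ := by ext h; simp
  norm_map' ξ := by
    have h2 : 0 < (2 : ℝ≥0∞).toReal := by norm_num
    rw [lp.norm_eq_tsum_rpow h2, lp.norm_eq_tsum_rpow h2]
    congr 1
    exact e.symm.tsum_eq (fun h => ‖ξ h‖ ^ (2 : ℝ≥0∞).toReal)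

@[simp] theorem permIsometry_apply {G : Type*} (e : Equiv.Perm G) (ξ : EllTwo G) (h : G) :
    permIsometry e ξ h = ξ (e.symm h) := rfl

/-- `permIsometry e` as an element of the unitary group of `B(ℓ²(G))`. -/
def permUnitary {G : Type*} (e : Equiv.Perm G) : unitary (EllTwo G →L[ℂ] EllTwo G) :=
  Unitary.linearIsometryEquiv.symm (permIsometry e)

@[simp] theorem permUnitary_apply {G : Type*} (e : Equiv.Perm G) (ξ : EllTwo G) :
    (permUnitary e : EllTwo G →L[ℂ] EllTwo G) ξ = permIsometry e ξ := rfl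

theorem permUnitary_mul {G : Type*} (e f : Equiv.Perm G) :
    permUnitary (e * f) = permUnitary e * permUnitary f := by
  ext ξ h; rfl

theorem permUnitary_inv {G : Type*} (e : Equiv.Perm G) :
    permUnitary e⁻¹ = star (permUnitary e) := by
  have h1 : permUnitary (1 : Equiv.Perm G) = 1 := by ext ξ h; rfl
  have : permUnitary e⁻¹ * permUnitary e = 1 := by rw [← permUnitary_mul]; simpa using h1
  exact eq_inv_of_mul_eq_one_left this

section Group

variable {G : Type*} [Group G]

/-- The left regular representation `(λ_g ξ)(h) = ξ (g⁻¹ h)` on `ℓ²(G)`. -/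
def leftReg (g : G) : EllTwo G →L[ℂ] EllTwo G :=
  permUnitary (Equiv.mulLeft g)

theorem leftReg_apply (g : G) (ξ : EllTwo G) (h : G) : leftReg g ξ h = ξ (g⁻¹ * h) := rfl

variable (G) in
/-- `C*_r(G)`: the closed unital `*`-subalgebra of `B(ℓ²(G))` generated by the `λ_g`. -/
def reducedCStar : StarSubalgebra ℂ (EllTwo G →L[ℂ] EllTwo G) :=
  (StarAlgebra.adjoin ℂ (Set.range (leftReg (G := G)))).topologicalClosure

instance reducedCStar_isClosed :
    IsClosed (reducedCStar G : Set (EllTwo G →L[ℂ] EllTwo G)) :=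
  StarSubalgebra.isClosed_topologicalClosure _

theorem leftReg_mem (g : G) : leftReg g ∈ reducedCStar G :=
  StarSubalgebra.le_topologicalClosure _ (StarAlgebra.subset_adjoin ℂ _ ⟨g, rfl⟩)

/-- `λ_g` as an element of `C*_r(G)`. -/
def lam (g : G) : reducedCStar G := ⟨leftReg g, leftReg_mem g⟩

/-- `C*_r(H) ⊆ C*_r(G)` for a subgroup `H` of `G`: the closed unital `*`-subalgebra of `C*_r(G)`
generated by the `λ_h` with `h ∈ H`. -/
def reducedCStarOf (H : Subgroup G) : StarSubalgebra ℂ (reducedCStar G) :=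
  (StarAlgebra.adjoin ℂ (lam '' (H : Set G))).topologicalClosure

/-! ### The automorphism of `C*_r(G)` induced by an automorphism of `G` -/

/-- `Ad U_β`, where `(U_β ξ)(h) = ξ (β⁻¹ h)`. -/
def adAut (β : MulAut G) :
    (EllTwo G →L[ℂ] EllTwo G) ≃⋆ₐ[ℂ] (EllTwo G →L[ℂ] EllTwo G) :=
  Unitary.conjStarAlgAut ℂ _ (permUnitary β.toEquiv)

theorem adAut_leftReg (β : MulAut G) (g : G) : adAut β (leftReg g) = leftReg (β g) := by
  have h : star (permUnitary β.toEquiv) = permUnitary (β.toEquiv)⁻¹ := (permUnitary_inv _).symm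
  rw [adAut, Unitary.conjStarAlgAut_apply, ← Unitary.coe_star, h]
  ext ξ x
  change ξ (β (g⁻¹ * β.symm x)) = ξ ((β g)⁻¹ * x)
  simp

theorem adAut_symm (β : MulAut G) : (adAut β).symm = adAut β⁻¹ := by
  have h : permUnitary (β⁻¹).toEquiv = star (permUnitary β.toEquiv) := permUnitary_inv _
  rw [adAut, Unitary.conjStarAlgAut_symm, ← h, adAut]

theorem adAut_mem (β : MulAut G) {x : EllTwo G →L[ℂ] EllTwo G} (hx : x ∈ reducedCStar G) :
    adAut β x ∈ reducedCStar G := by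
  have hcont : Continuous (adAut β) := by
    change Continuous fun x : EllTwo G →L[ℂ] EllTwo G =>
      (permUnitary β.toEquiv : EllTwo G →L[ℂ] EllTwo G) * x *
        (star (permUnitary β.toEquiv) : EllTwo G →L[ℂ] EllTwo G)
    exact (continuous_const.mul continuous_id).mul continuous_const
  have hle : StarAlgebra.adjoin ℂ (Set.range (leftReg (G := G))) ≤
      (reducedCStar G).comap (adAut β : _ →⋆ₐ[ℂ] _) := by
    refine StarAlgebra.adjoin_le ?_
    rintro _ ⟨g, rfl⟩
    change adAut β (leftReg g) ∈ reducedCStar G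
    rw [adAut_leftReg]
    exact leftReg_mem _
  exact StarSubalgebra.topologicalClosure_minimal hle
    (reducedCStar_isClosed.preimage hcont) hx

/-- The automorphism `α` of `C*_r(G)` induced by the automorphism `β` of `G`,
that is, the restriction of `Ad U_β` to `C*_r(G)`. -/
def inducedAut (β : MulAut G) : reducedCStar G ≃⋆ₐ[ℂ] reducedCStar G where
  toFun x := ⟨adAut β x, adAut_mem β x.2⟩
  invFun x := ⟨adAut β⁻¹ x, adAut_mem β⁻¹ x.2⟩
  left_inv x := Subtype.ext <| by
    change adAut β⁻¹ (adAut β x) = x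
    rw [← adAut_symm]; simp
  right_inv x := Subtype.ext <| by
    change adAut β (adAut β⁻¹ x) = x
    rw [← adAut_symm]; simp
  map_mul' x y := Subtype.ext (map_mul (adAut β) _ _)
  map_add' x y := Subtype.ext (map_add (adAut β) _ _)
  map_star' x := Subtype.ext (map_star (adAut β) _)
  map_smul' c x := Subtype.ext (map_smul (adAut β) c _)

/-- `α (λ_g) = λ_{β g}`, which determines `α`. -/
theorem inducedAut_lam (β : MulAut G) (g : G) : inducedAut β (lam g) = lam (β g) :=
  Subtype.ext (adAut_leftReg β g)

/-- `α` as a linear map. -/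
def inducedLin (β : MulAut G) : reducedCStar G →ₗ[ℂ] reducedCStar G where
  toFun := inducedAut β
  map_add' := map_add (inducedAut β)
  map_smul' := map_smul (inducedAut β)

/-- The subgroup `{g ∈ G : β g = g}`. -/
def fixedSubgroup (β : MulAut G) : Subgroup G where
  carrier := {g | β g = g}
  mul_mem' ha hb := by
    change β (_ * _) = _ * _
    rw [map_mul, ha, hb]
  one_mem' := map_one β
  inv_mem' ha := by
    change β _⁻¹ = _⁻¹
    rw [map_inv, ha]

/-! ### Rapid decay -/

/-- `ξ` is rapidly decreasing for the length function `L`: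
`∑_g |ξ(g)|² (1 + L(g))^{2s} < ∞` for all `s`. -/
def IsRapidlyDecreasing (L : GroupSeminorm G) (ξ : EllTwo G) : Prop :=
  ∀ s : ℝ, Summable fun g => ‖ξ g‖ ^ 2 * (1 + L g) ^ (2 * s)

open Classical in
/-- `G` is an RD-group for the length function `L`: every rapidly decreasing function belongs to
`C*_r(G)`, where `C*_r(G)` is viewed inside `ℓ²(G)` through the injection `a ↦ a δ_1`. -/
def IsRDGroup (L : GroupSeminorm G) : Prop :=
  ∀ ξ : EllTwo G, IsRapidlyDecreasing L ξ →
    ∃ a ∈ reducedCStar G, a (lp.single 2 (1 : G) (1 : ℂ)) = ξ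

end Group

end

noncomputable section

/-! The span of the `λ_g` is dense in `C*_r(G)`, and every limit statement involved is stable under
linear combinations and norm limits, so it suffices to treat a single `λ_g`. If `β g = g` nothing
moves. Otherwise the elements `β^k g` are pairwise distinct and lie on one sphere `L = r`.

On a sphere the weights `(1 + L)^{2s}` are constant, so RD puts every `ℓ²` function supported there
into `C*_r(G)`. The bounded inverse theorem turns this inclusion into a Haagerup inequality `‖a‖ ≤ C
‖a δ_1‖` (`IsRDGroup.exists_norm_le_evalOne`). A sum of `n` of the `λ_{β^k g}` with unimodular
coefficients thus has norm at most `C √n`, which is negligible after division by `n`. Coefficients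
`1` give convergence of the Cesàro means to `0`; coefficients cancelling the phases of `φ(λ_{β^k
g})` give weak mixing.

The limit `E` therefore fixes `λ_g` for `g ∈ H` and kills the other `λ_g`, so its values lie in
`C*_r(H)`; a fixed point `x` equals `E x` and lies there too. -/

/-- A bounded injective map of Banach spaces is bounded below on the preimage of a closed subspace
of its range. -/
theorem ContinuousLinearMap.exists_norm_le_of_injective_of_le_range {E F : Type*}
    [NormedAddCommGroup E] [NormedSpace ℂ E] [CompleteSpace E]
    [NormedAddCommGroup F] [NormedSpace ℂ F] [CompleteSpace F] (T : E →L[ℂ] F)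
    (hT : Function.Injective T) {W : Submodule ℂ F} (hW : IsClosed (W : Set F))
    (hWT : ∀ y ∈ W, ∃ x, T x = y) : ∃ C : ℝ, ∀ x, T x ∈ W → ‖x‖ ≤ C * ‖T x‖ := by
  let V : Submodule ℂ E := W.comap (T : E →ₗ[ℂ] F)
  have hV : IsClosed (V : Set E) := hW.preimage T.continuous
  have : CompleteSpace W := hW.completeSpace_coe
  have : CompleteSpace V := hV.completeSpace_coe
  -- `f` is a bounded bijection between Banach spaces; the norm of its inverse serves as `C`.
  let f : V →L[ℂ] W := (T.comp V.subtypeL).codRestrict W fun x => x.2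
  have hker : f.ker = ⊥ :=
    LinearMap.ker_eq_bot.2 fun x y hxy => Subtype.ext (hT (congrArg Subtype.val hxy))
  have hran : f.range = ⊤ := by
    refine LinearMap.range_eq_top.2 fun y => ?_
    obtain ⟨x, hx⟩ := hWT y y.2
    exact ⟨⟨x, by change T x ∈ W; rw [hx]; exact y.2⟩, Subtype.ext hx⟩
  let e := ContinuousLinearEquiv.ofBijective f hker hran
  refine ⟨‖(e.symm : W →L[ℂ] V)‖, fun x hx => ?_⟩
  have h := (e.symm : W →L[ℂ] V).le_opNorm (f ⟨x, hx⟩)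
  have h3 : (e.symm : W →L[ℂ] V) (f ⟨x, hx⟩) = ⟨x, hx⟩ :=
    ContinuousLinearEquiv.ofBijective_symm_apply_apply f hker hran _
  rw [h3] at h
  exact h

/-! ### The regular representation: density of the span and injectivity of `a ↦ a δ_1` -/

section Density

open Classical in
theorem permIsometry_single {G : Type*} (e : Equiv.Perm G) (g : G) (c : ℂ) :
    permIsometry e (lp.single 2 g c) = lp.single 2 (e g) c := by
  ext h
  rw [permIsometry_apply, lp.single_apply, lp.single_apply]
  simp only [Pi.single_apply, Equiv.symm_apply_eq]

variable {G : Type*} [Group G]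

theorem leftReg_one : leftReg (1 : G) = 1 := by
  ext ξ h
  rw [leftReg_apply]
  simp

theorem leftReg_mul (g h : G) : leftReg (g * h) = leftReg g * leftReg h := by
  ext ξ x
  change ξ ((g * h)⁻¹ * x) = ξ (h⁻¹ * (g⁻¹ * x))
  rw [mul_inv_rev, mul_assoc]

theorem star_leftReg (g : G) : star (leftReg g) = leftReg g⁻¹ := by
  have h := permUnitary_inv (Equiv.mulLeft g)
  rw [leftReg, leftReg, ← Unitary.coe_star, ← h]
  ext ξ x
  change ξ (g * x) = ξ (g⁻¹⁻¹ * x)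
  rw [inv_inv]

/-- The `λ_g` form a group of unitaries, so their span is already closed under products and
adjoints. -/
theorem adjoin_leftReg_le_span {a : EllTwo G →L[ℂ] EllTwo G}
    (ha : a ∈ StarAlgebra.adjoin ℂ (Set.range (leftReg (G := G)))) :
    a ∈ Submodule.span ℂ (Set.range (leftReg (G := G))) := by
  induction ha using StarAlgebra.adjoin_induction with
  | mem x hx => exact Submodule.subset_span hx
  | algebraMap r =>
    rw [Algebra.algebraMap_eq_smul_one, ← leftReg_one]
    exact Submodule.smul_mem _ _ (Submodule.subset_span ⟨1, rfl⟩)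
  | add x y _ _ hx hy => exact add_mem hx hy
  | mul x y hx' hy' hx hy =>
    clear hx' hy'
    induction hx using Submodule.span_induction with
    | mem x hx =>
      obtain ⟨g, rfl⟩ := hx
      induction hy using Submodule.span_induction with
      | mem y hy =>
        obtain ⟨h, rfl⟩ := hy
        exact Submodule.subset_span ⟨g * h, leftReg_mul g h⟩
      | zero => simp
      | add y z _ _ hy hz => rw [mul_add]; exact add_mem hy hz
      | smul c y _ hy => rw [mul_smul_comm]; exact Submodule.smul_mem _ _ hy
    | zero => simp
    | add y z _ _ hy hz => rw [add_mul]; exact add_mem hy hz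
    | smul c y _ hy => rw [smul_mul_assoc]; exact Submodule.smul_mem _ _ hy
  | star x hx' hx =>
    clear hx'
    induction hx using Submodule.span_induction with
    | mem x hx =>
      obtain ⟨g, rfl⟩ := hx
      rw [star_leftReg]
      exact Submodule.subset_span ⟨_, rfl⟩
    | zero => simp
    | add y z _ _ hy hz => rw [star_add]; exact add_mem hy hz
    | smul c y _ hy => rw [star_smul]; exact Submodule.smul_mem _ _ hy

/-- A closed property that passes to linear combinations holds on `C*_r(G)` once it holds for
the `λ_g`. -/
theorem reducedCStar_induction {p : reducedCStar G → Prop} (closed : IsClosed {x | p x})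
    (lam_mem : ∀ g, p (lam g)) (add : ∀ x y, p x → p y → p (x + y))
    (smul : ∀ (c : ℂ) x, p x → p (c • x)) (x : reducedCStar G) : p x := by
  let M : Submodule ℂ (reducedCStar G) :=
    { carrier := {x | p x}
      add_mem' := fun {x y} hx hy => add x y hx hy
      zero_mem' := by simpa using smul 0 _ (lam_mem 1)
      smul_mem' := smul }
  have hspan : ∀ a ∈ Submodule.span ℂ (Set.range (leftReg (G := G))),
      a ∈ Submodule.map (reducedCStar G).subtype.toLinearMap M := by
    intro a ha
    refine Submodule.span_le.2 ?_ ha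
    rintro _ ⟨g, rfl⟩
    exact ⟨lam g, lam_mem g, rfl⟩
  have hx : (x : EllTwo G →L[ℂ] EllTwo G) ∈
      closure (StarAlgebra.adjoin ℂ (Set.range (leftReg (G := G))) :
        Set (EllTwo G →L[ℂ] EllTwo G)) := by
    rw [← StarSubalgebra.topologicalClosure_coe]
    exact x.2
  have : x ∈ closure {x | p x} := by
    -- The topology of `C*_r(G)` is induced from `B(ℓ²(G))`, so density can be checked there.
    rw [Topology.IsInducing.subtypeVal.closure_eq_preimage_closure_image]
    refine closure_mono ?_ hx
    intro a ha
    obtain ⟨y, hy, rfl⟩ := hspan a (adjoin_leftReg_le_span ha)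
    exact ⟨y, hy, rfl⟩
  rwa [closed.closure_eq] at this

open Classical in
/-- The map `a ↦ a δ_1` from `C*_r(G)` to `ℓ²(G)`. -/
def evalOne : reducedCStar G →L[ℂ] EllTwo G :=
  (ContinuousLinearMap.apply ℂ (EllTwo G) (lp.single 2 (1 : G) (1 : ℂ))).comp
    (reducedCStar G).toSubalgebra.toSubmodule.subtypeL

open Classical in
theorem evalOne_apply (a : reducedCStar G) :
    evalOne a = (a : EllTwo G →L[ℂ] EllTwo G) (lp.single 2 (1 : G) (1 : ℂ)) := rfl

open Classical in
theorem evalOne_lam (g : G) : evalOne (lam g) = lp.single 2 g (1 : ℂ) := by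
  have := permIsometry_single (Equiv.mulLeft g) 1 (1 : ℂ)
  rw [Equiv.coe_mulLeft] at this
  simp only [mul_one] at this
  exact this

/-- Left and right translations commute by associativity, and commutation survives linear
combinations and limits. -/
theorem reducedCStar_commute_mulRight (a : reducedCStar G) (g : G) (ξ : EllTwo G) :
    (a : EllTwo G →L[ℂ] EllTwo G) (permIsometry (Equiv.mulRight g) ξ) =
      permIsometry (Equiv.mulRight g) ((a : EllTwo G →L[ℂ] EllTwo G) ξ) := by
  induction a using reducedCStar_induction with
  | closed =>
    have h (η : EllTwo G) : Continuous fun a : reducedCStar G =>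
        (a : EllTwo G →L[ℂ] EllTwo G) η :=
      (ContinuousLinearMap.apply ℂ (EllTwo G) η).continuous.comp continuous_subtype_val
    exact isClosed_eq (h _) ((permIsometry _).continuous.comp (h _))
  | lam_mem h =>
    ext x
    change ξ (h⁻¹ * x * g⁻¹) = ξ (h⁻¹ * (x * g⁻¹))
    rw [mul_assoc]
  | add x y hx hy =>
    change x.1 _ + y.1 _ = permIsometry _ (x.1 _ + y.1 _)
    rw [hx, hy, map_add]
  | smul c x hx =>
    change c • x.1 _ = permIsometry _ (c • x.1 _)
    rw [hx, map_smul]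

/-- The vector `δ_1` is separating: right translations carry it to every `δ_g` and commute with `a`,
so `a δ_1 = 0` forces `a δ_g = 0` for all `g`. -/
theorem evalOne_injective : Function.Injective (evalOne (G := G)) := by
  classical
  rw [injective_iff_map_eq_zero]
  intro a ha
  have hsingle (g : G) (c : ℂ) : (a : EllTwo G →L[ℂ] EllTwo G) (lp.single 2 g c) = 0 := by
    have h1 : lp.single 2 g c = c • permIsometry (Equiv.mulRight g)
        (lp.single 2 (1 : G) (1 : ℂ)) := by
      rw [permIsometry_single, ← lp.single_smul]
      simp
    rw [h1, map_smul, reducedCStar_commute_mulRight]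
    have h2 : (a : EllTwo G →L[ℂ] EllTwo G) (lp.single 2 (1 : G) (1 : ℂ)) = 0 := by
      rw [← ha, evalOne_apply]
    rw [h2, map_zero, smul_zero]
  refine Subtype.ext (ContinuousLinearMap.ext fun ξ => ?_)
  have h := (lp.hasSum_single (by simp) ξ).mapL (a : EllTwo G →L[ℂ] EllTwo G)
  simp only [hsingle] at h
  exact h.unique hasSum_zero

/-! ### Haagerup inequality on spheres and its consequences for means -/

/-- Elements of `C*_r(G)` supported on a set on which the length function is constant obey a
Haagerup inequality. -/
theorem IsRDGroup.exists_norm_le_evalOne {L : GroupSeminorm G} (hRD : IsRDGroup L) {S : Set G}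
    {r : ℝ} (hS : ∀ g ∈ S, L g = r) :
    ∃ C : ℝ, ∀ a : reducedCStar G, (∀ g ∉ S, evalOne a g = 0) → ‖a‖ ≤ C * ‖evalOne a‖ := by
  let W : Submodule ℂ (EllTwo G) :=
    { carrier := {ξ | ∀ g ∉ S, ξ g = 0}
      add_mem' := fun {x y} hx hy g hg => by
        rw [lp.coeFn_add, Pi.add_apply, hx g hg, hy g hg, add_zero]
      zero_mem' := fun g _ => rfl
      smul_mem' := fun c x hx g hg => by
        rw [lp.coeFn_smul, Pi.smul_apply, hx g hg, smul_zero] }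
  have hW : IsClosed (W : Set (EllTwo G)) := by
    have : (W : Set (EllTwo G)) = ⋂ g ∈ Sᶜ, {ξ | ξ g = 0} := by
      ext ξ
      simp only [Set.mem_iInter]
      rfl
    rw [this]
    refine isClosed_biInter fun g _ => isClosed_eq ?_ continuous_const
    exact (lp.evalCLM ℂ (fun _ : G => ℂ) 2 g).continuous
  refine evalOne.exists_norm_le_of_injective_of_le_range evalOne_injective hW fun ξ hξW => ?_
  have hdec : IsRapidlyDecreasing L ξ := by
    intro s
    have h2 : 0 < (2 : ℝ≥0∞).toReal := by norm_num
    have hs := (memℓp_gen_iff h2).1 (lp.memℓp ξ)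
    simp only [ENNReal.toReal_ofNat, Real.rpow_ofNat] at hs
    -- On `S` the weight is this constant; off `S` both sides vanish.
    refine (hs.mul_right ((1 + r) ^ (2 * s))).congr fun g => ?_
    by_cases hg : g ∈ S
    · rw [hS g hg]
    · rw [hξW g hg]
      simp
  obtain ⟨a, ha, hξ⟩ := hRD ξ hdec
  exact ⟨⟨a, ha⟩, hξ⟩

/-- On a set of elements of equal length, linear combinations of the `λ_g` are bounded by the
`ℓ²` norm of their coefficients. -/
theorem IsRDGroup.exists_norm_sum_lam_le {L : GroupSeminorm G} (hRD : IsRDGroup L) {u : ℕ → G}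
    (hu : Function.Injective u) {r : ℝ} (hL : ∀ k, L (u k) = r) :
    ∃ C : ℝ, ∀ (s : Finset ℕ) (c : ℕ → ℂ),
      ‖∑ k ∈ s, c k • lam (u k)‖ ≤ C * √(∑ k ∈ s, ‖c k‖ ^ 2) := by
  classical
  obtain ⟨C, hC⟩ := hRD.exists_norm_le_evalOne (S := Set.range u) (r := r)
    (by rintro _ ⟨k, rfl⟩; exact hL k)
  refine ⟨C, fun s c => ?_⟩
  let d : G → ℂ := Function.extend u c 0
  have hd (k : ℕ) : d (u k) = c k := hu.extend_apply _ _ _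
  have h1 : evalOne (∑ k ∈ s, c k • lam (u k)) =
      ∑ g ∈ s.map ⟨u, hu⟩, lp.single 2 g (d g) := by
    rw [map_sum, Finset.sum_map]
    refine Finset.sum_congr rfl fun k _ => ?_
    rw [map_smul, evalOne_lam, ← lp.single_smul]
    simp only [Function.Embedding.coeFn_mk, hd, smul_eq_mul, mul_one]
  have h2 : ‖evalOne (∑ k ∈ s, c k • lam (u k))‖ = √(∑ k ∈ s, ‖c k‖ ^ 2) := by
    have := lp.norm_sum_single (p := 2) (by norm_num) d (s.map ⟨u, hu⟩)
    rw [← h1, Finset.sum_map] at this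
    simp only [Function.Embedding.coeFn_mk, hd, ENNReal.toReal_ofNat, Real.rpow_ofNat] at this
    rw [← this, Real.sqrt_sq (norm_nonneg _)]
  rw [← h2]
  refine hC _ fun g hg => ?_
  rw [h1, lp.coeFn_sum, Finset.sum_apply]
  refine Finset.sum_eq_zero fun h hh => lp.single_apply_ne _ _ _ ?_
  rintro rfl
  obtain ⟨k, -, rfl⟩ := Finset.mem_map.1 hh
  exact hg ⟨k, rfl⟩

/-- `(1/n) ∑_{k<n} |φ(λ_{u k})| → 0` for a bounded functional `φ` and an injective sequence `u`
of elements of equal length. -/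
theorem IsRDGroup.tendsto_mean_norm_lam {L : GroupSeminorm G} (hRD : IsRDGroup L) {u : ℕ → G}
    (hu : Function.Injective u) {r : ℝ} (hL : ∀ k, L (u k) = r) (φ : reducedCStar G →L[ℂ] ℂ) :
    Tendsto (fun n : ℕ => (n : ℝ)⁻¹ * ∑ k ∈ Finset.range n, ‖φ (lam (u k))‖) atTop (𝓝 0) := by
  obtain ⟨C, hC⟩ := hRD.exists_norm_sum_lam_le hu hL
  have hlim : Tendsto (fun n : ℕ => ‖φ‖ * C * (√(n : ℝ))⁻¹) atTop (𝓝 0) := by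
    simpa using ((Real.tendsto_sqrt_atTop.comp
      tendsto_natCast_atTop_atTop).inv_tendsto_atTop).const_mul (‖φ‖ * C)
  refine squeeze_zero (fun n => by positivity) (fun n => ?_) hlim
  -- The phase must have modulus one even at `z = 0`, so that the `ℓ²` norm of the coefficients is
  -- exactly `√n`.
  have hphase (z : ℂ) : ∃ c : ℂ, ‖c‖ = 1 ∧ c * z = ‖z‖ := by
    rcases eq_or_ne z 0 with rfl | hz
    · exact ⟨1, by simp⟩
    · have hz' : (‖z‖ : ℂ) ≠ 0 := by simpa using hz
      exact ⟨‖z‖ / z, by simp [hz], by field_simp⟩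
  choose c hc1 hc2 using fun k => hphase (φ (lam (u k)))
  have h1 : ∑ k ∈ Finset.range n, ‖φ (lam (u k))‖ ≤ ‖φ‖ * (C * √(n : ℝ)) := by
    calc ∑ k ∈ Finset.range n, ‖φ (lam (u k))‖
        = ‖φ (∑ k ∈ Finset.range n, c k • lam (u k))‖ := by
          simp only [map_sum, map_smul, smul_eq_mul, hc2]
          rw [← Complex.ofReal_sum, Complex.norm_real, Real.norm_of_nonneg (by positivity)]
      _ ≤ ‖φ‖ * ‖∑ k ∈ Finset.range n, c k • lam (u k)‖ := φ.le_opNorm _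
      _ ≤ ‖φ‖ * (C * √(n : ℝ)) := by
          gcongr
          simpa [hc1] using hC (Finset.range n) c
  rcases Nat.eq_zero_or_pos n with rfl | hn
  · simp
  have hn' : 0 < √(n : ℝ) := by positivity
  calc (n : ℝ)⁻¹ * ∑ k ∈ Finset.range n, ‖φ (lam (u k))‖ ≤ (n : ℝ)⁻¹ * (‖φ‖ * (C * √(n : ℝ))) := by
        gcongr
    _ = ‖φ‖ * C * (√(n : ℝ))⁻¹ := by
        rw [← Real.mul_self_sqrt (Nat.cast_nonneg n : (0 : ℝ) ≤ n), Real.sqrt_mul_self hn'.le]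
        field_simp

theorem IsRDGroup.tendsto_mean_lam {L : GroupSeminorm G} (hRD : IsRDGroup L) {u : ℕ → G}
    (hu : Function.Injective u) {r : ℝ} (hL : ∀ k, L (u k) = r) :
    Tendsto (fun n : ℕ => (n : ℂ)⁻¹ • ∑ k ∈ Finset.range n, lam (u k)) atTop (𝓝 0) := by
  obtain ⟨C, hC⟩ := hRD.exists_norm_sum_lam_le hu hL
  have hlim : Tendsto (fun n : ℕ => C * (√(n : ℝ))⁻¹) atTop (𝓝 0) := by
    simpa using ((Real.tendsto_sqrt_atTop.comp
      tendsto_natCast_atTop_atTop).inv_tendsto_atTop).const_mul C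
  refine squeeze_zero_norm (fun n => ?_) hlim
  rcases Nat.eq_zero_or_pos n with rfl | hn
  · simp
  have hn' : 0 < √(n : ℝ) := by positivity
  have h := hC (Finset.range n) 1
  simp only [Pi.one_apply, one_smul, norm_one, one_pow, Finset.sum_const, Finset.card_range,
    nsmul_eq_mul, mul_one] at h
  rw [norm_smul, norm_inv, Complex.norm_natCast]
  calc (n : ℝ)⁻¹ * ‖∑ k ∈ Finset.range n, lam (u k)‖ ≤ (n : ℝ)⁻¹ * (C * √(n : ℝ)) := by gcongr
    _ = C * (√(n : ℝ))⁻¹ := by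
        rw [← Real.mul_self_sqrt (Nat.cast_nonneg n : (0 : ℝ) ≤ n), Real.sqrt_mul_self hn'.le]
        field_simp

end Density

/-! ### Cesàro means and mean deviations of linear contractions -/

section Ergodic

/-- An `ε/3` argument: uniformly 1-Lipschitz maps transfer the Cauchy property from a nearby point,
and completeness supplies the limit. -/
theorem isClosed_setOf_exists_tendsto {V : Type*} [NormedAddCommGroup V] [CompleteSpace V]
    {S : ℕ → V → V} (hS : ∀ n x y, ‖S n x - S n y‖ ≤ ‖x - y‖) :
    IsClosed {x | ∃ y, Tendsto (fun n => S n x) atTop (𝓝 y)} := by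
  refine isClosed_of_closure_subset fun x hx => ?_
  refine cauchySeq_tendsto_of_complete (Metric.cauchySeq_iff'.2 fun ε hε => ?_)
  obtain ⟨y, ⟨z, hz⟩, hxy⟩ := Metric.mem_closure_iff.1 hx (ε / 3) (by positivity)
  obtain ⟨N, hN⟩ := Metric.cauchySeq_iff'.1 hz.cauchySeq (ε / 3) (by positivity)
  refine ⟨N, fun n hn => ?_⟩
  have h1 : dist (S n x) (S n y) ≤ dist x y := by
    simpa only [dist_eq_norm] using hS n x y
  have h2 : dist (S N y) (S N x) ≤ dist x y := by
    simpa only [dist_eq_norm, norm_sub_rev] using hS N x y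
  linarith [hN n hn, dist_triangle4 (S n x) (S n y) (S N y) (S N x)]

theorem isClosed_setOf_tendsto_zero {V : Type*} [NormedAddCommGroup V] {p : ℕ → V → ℝ} {C : ℝ}
    (hp : ∀ n x y, |p n x - p n y| ≤ C * ‖x - y‖) :
    IsClosed {x | Tendsto (fun n => p n x) atTop (𝓝 0)} := by
  refine isClosed_of_closure_subset fun x hx => ?_
  refine Metric.tendsto_atTop.2 fun ε hε => ?_
  -- `|C| + 1` keeps the denominator positive whatever the sign of `C`.
  obtain ⟨y, hy, hxy⟩ := Metric.mem_closure_iff.1 hx (ε / (2 * (|C| + 1))) (by positivity)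
  obtain ⟨N, hN⟩ := Metric.tendsto_atTop.1 hy (ε / 2) (by positivity)
  refine ⟨N, fun n hn => ?_⟩
  have h1 : C * ‖x - y‖ ≤ ε / 2 := by
    rw [dist_eq_norm, lt_div_iff₀ (by positivity)] at hxy
    nlinarith [le_abs_self C, norm_nonneg (x - y)]
  calc dist (p n x) 0 ≤ dist (p n x) (p n y) + dist (p n y) 0 := dist_triangle _ _ _
    _ < ε / 2 + ε / 2 := add_lt_add_of_le_of_lt ((hp n x y).trans h1) (hN n hn)
    _ = ε := add_halves ε

/-- The Cesàro means `(1/n) ∑_{k<n} T^k` of a linear map. -/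
def cesaroMean {V : Type*} [AddCommGroup V] [Module ℂ V] (T : V →ₗ[ℂ] V) (n : ℕ) : V →ₗ[ℂ] V :=
  (n : ℂ)⁻¹ • ∑ k ∈ Finset.range n, T ^ k

theorem cesaroMean_apply {V : Type*} [AddCommGroup V] [Module ℂ V] (T : V →ₗ[ℂ] V) (n : ℕ)
    (x : V) : cesaroMean T n x = (n : ℂ)⁻¹ • ∑ k ∈ Finset.range n, (T ^ k) x := by
  rw [cesaroMean, LinearMap.smul_apply, LinearMap.sum_apply]

theorem tendsto_cesaroMean_of_fixed {V : Type*} [NormedAddCommGroup V] [NormedSpace ℂ V]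
    {T : V →ₗ[ℂ] V} {x : V} (hx : T x = x) :
    Tendsto (fun n => cesaroMean T n x) atTop (𝓝 x) := by
  refine tendsto_const_nhds.congr' ?_
  -- The mean for `n = 0` is `0`, so the sequence is constant only from `n = 1` on.
  filter_upwards [eventually_ne_atTop 0] with n hn
  have h (k : ℕ) : (T ^ k) x = x := by
    rw [Module.End.pow_apply]
    exact Function.iterate_fixed hx k
  have hn' : (n : ℂ) ≠ 0 := by exact_mod_cast hn
  simp only [cesaroMean_apply, h, Finset.sum_const, Finset.card_range]
  rw [← Nat.cast_smul_eq_nsmul ℂ, inv_smul_smul₀ hn']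

section Contraction

variable {V : Type*} [NormedAddCommGroup V] [NormedSpace ℂ V] {T : V →ₗ[ℂ] V}

theorem norm_pow_apply_le (hT : ∀ x, ‖T x‖ ≤ ‖x‖) (k : ℕ) (x : V) : ‖(T ^ k) x‖ ≤ ‖x‖ := by
  induction k with
  | zero => simp
  | succ k ih => rw [pow_succ']; exact (hT _).trans ih

theorem norm_cesaroMean_le (hT : ∀ x, ‖T x‖ ≤ ‖x‖) (n : ℕ) (x : V) :
    ‖cesaroMean T n x‖ ≤ ‖x‖ := by
  rw [cesaroMean_apply, norm_smul, norm_inv, Complex.norm_natCast]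
  rcases Nat.eq_zero_or_pos n with rfl | hn
  · simp
  rw [inv_mul_le_iff₀ (by positivity)]
  calc ‖∑ k ∈ Finset.range n, (T ^ k) x‖ ≤ ∑ _k ∈ Finset.range n, ‖x‖ :=
        norm_sum_le_of_le _ fun k _ => norm_pow_apply_le hT k x
    _ = n * ‖x‖ := by simp

theorem isClosed_setOf_exists_tendsto_cesaroMean [CompleteSpace V] (hT : ∀ x, ‖T x‖ ≤ ‖x‖) :
    IsClosed {x | ∃ y, Tendsto (fun n => cesaroMean T n x) atTop (𝓝 y)} :=
  isClosed_setOf_exists_tendsto fun n x y => by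
    rw [← map_sub]
    exact norm_cesaroMean_le hT n _

/-- Pointwise convergent Cesàro means of a linear contraction converge to a linear contraction. -/
theorem exists_continuousLinearMap_tendsto_cesaroMean (hT : ∀ x, ‖T x‖ ≤ ‖x‖)
    (h : ∀ x, ∃ y, Tendsto (fun n => cesaroMean T n x) atTop (𝓝 y)) :
    ∃ E : V →L[ℂ] V, (∀ x, ‖E x‖ ≤ ‖x‖) ∧
      ∀ x, Tendsto (fun n => cesaroMean T n x) atTop (𝓝 (E x)) := by
  choose F hF using h
  have hle (x : V) : ‖F x‖ ≤ ‖x‖ :=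
    le_of_tendsto (hF x).norm (Eventually.of_forall fun n => norm_cesaroMean_le hT n x)
  let E : V →ₗ[ℂ] V := linearMapOfTendsto F (cesaroMean T) (tendsto_pi_nhds.2 hF)
  exact ⟨E.mkContinuous 1 fun x => by rw [one_mul]; exact hle x, hle, hF⟩

/-- The mean deviation `(1/n) ∑_{k<n} |φ(T^k x) - φ(E x)|`. -/
def meanDeviation (T : V →ₗ[ℂ] V) (E : V →L[ℂ] V) (φ : V →L[ℂ] ℂ) (n : ℕ) (x : V) : ℝ :=
  (n : ℝ)⁻¹ * ∑ k ∈ Finset.range n, ‖φ ((T ^ k) x) - φ (E x)‖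

variable {E : V →L[ℂ] V} {φ : V →L[ℂ] ℂ}

theorem meanDeviation_nonneg (n : ℕ) (x : V) : 0 ≤ meanDeviation T E φ n x := by
  unfold meanDeviation
  positivity

theorem meanDeviation_add_le (n : ℕ) (x y : V) :
    meanDeviation T E φ n (x + y) ≤ meanDeviation T E φ n x + meanDeviation T E φ n y := by
  unfold meanDeviation
  rw [← mul_add, ← Finset.sum_add_distrib]
  gcongr with k _
  simp only [map_add]
  rw [add_sub_add_comm]
  exact norm_add_le _ _

theorem meanDeviation_smul (n : ℕ) (c : ℂ) (x : V) :
    meanDeviation T E φ n (c • x) = ‖c‖ * meanDeviation T E φ n x := by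
  unfold meanDeviation
  simp only [map_smul, ← smul_sub, norm_smul, ← Finset.mul_sum]
  ring

theorem meanDeviation_le (hT : ∀ x, ‖T x‖ ≤ ‖x‖) (hE : ∀ x, ‖E x‖ ≤ ‖x‖) (n : ℕ) (x : V) :
    meanDeviation T E φ n x ≤ 2 * ‖φ‖ * ‖x‖ := by
  unfold meanDeviation
  rcases Nat.eq_zero_or_pos n with rfl | hn
  · simp only [CharP.cast_eq_zero, inv_zero, zero_mul]
    positivity
  rw [inv_mul_le_iff₀ (by positivity)]
  calc ∑ k ∈ Finset.range n, ‖φ ((T ^ k) x) - φ (E x)‖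
      ≤ ∑ _k ∈ Finset.range n, 2 * ‖φ‖ * ‖x‖ := by
        refine Finset.sum_le_sum fun k _ => ?_
        calc ‖φ ((T ^ k) x) - φ (E x)‖ ≤ ‖φ ((T ^ k) x)‖ + ‖φ (E x)‖ := norm_sub_le _ _
          _ ≤ ‖φ‖ * ‖x‖ + ‖φ‖ * ‖x‖ :=
            add_le_add (φ.le_opNorm_of_le (norm_pow_apply_le hT k x)) (φ.le_opNorm_of_le (hE x))
          _ = 2 * ‖φ‖ * ‖x‖ := by ring
    _ = n * (2 * ‖φ‖ * ‖x‖) := by simp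

/-- Each deviation is a seminorm bounded by `2 ‖φ‖ ‖x‖`, hence Lipschitz with a constant independent
of `n`. -/
theorem isClosed_setOf_tendsto_meanDeviation (hT : ∀ x, ‖T x‖ ≤ ‖x‖) (hE : ∀ x, ‖E x‖ ≤ ‖x‖) :
    IsClosed {x | Tendsto (fun n => meanDeviation T E φ n x) atTop (𝓝 0)} := by
  refine isClosed_setOf_tendsto_zero (C := 2 * ‖φ‖) fun n x y => abs_sub_le_iff.2 ⟨?_, ?_⟩
  · have h := meanDeviation_add_le (T := T) (E := E) (φ := φ) n y (x - y)
    rw [add_sub_cancel] at h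
    linarith [meanDeviation_le (φ := φ) hT hE n (x - y)]
  · have h := meanDeviation_add_le (T := T) (E := E) (φ := φ) n x (y - x)
    rw [add_sub_cancel] at h
    rw [norm_sub_rev]
    linarith [meanDeviation_le (φ := φ) hT hE n (y - x)]

theorem tendsto_meanDeviation_add {x y : V}
    (hx : Tendsto (fun n => meanDeviation T E φ n x) atTop (𝓝 0))
    (hy : Tendsto (fun n => meanDeviation T E φ n y) atTop (𝓝 0)) :
    Tendsto (fun n => meanDeviation T E φ n (x + y)) atTop (𝓝 0) := by
  have h := hx.add hy
  rw [add_zero] at h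
  exact squeeze_zero (fun n => meanDeviation_nonneg n _) (fun n => meanDeviation_add_le n x y) h

theorem tendsto_meanDeviation_smul (c : ℂ) {x : V}
    (hx : Tendsto (fun n => meanDeviation T E φ n x) atTop (𝓝 0)) :
    Tendsto (fun n => meanDeviation T E φ n (c • x)) atTop (𝓝 0) := by
  simp only [meanDeviation_smul]
  simpa using hx.const_mul ‖c‖

theorem tendsto_meanDeviation_of_fixed {x : V} (hT : T x = x) (hE : E x = x) :
    Tendsto (fun n => meanDeviation T E φ n x) atTop (𝓝 0) := by
  have h (k : ℕ) : (T ^ k) x = x := by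
    rw [Module.End.pow_apply]
    exact Function.iterate_fixed hT k
  simp [meanDeviation, h, hE]

end Contraction

end Ergodic

/-! ### Orbits of `β` and the induced automorphism -/

section Induced

variable {G : Type*} [Group G] {β : MulAut G}

theorem MulAut.fixed_or_injective_of_orbit {g : G}
    (horb : (MulAction.orbit (Subgroup.zpowers β) g).Infinite ∨
      ∃ x : G, MulAction.orbit (Subgroup.zpowers β) g = {x}) :
    β g = g ∨ Function.Injective fun k : ℕ => (β ^ k) g := by
  rcases horb with h | ⟨x, hx⟩
  · right
    -- Minimal period `0` encodes a point that is not periodic; a positive period would make the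
    -- orbit finite.
    have hp : Function.minimalPeriod (β • ·) g = 0 := by
      by_contra hne
      have : NeZero (Function.minimalPeriod (β • ·) g) := ⟨hne⟩
      refine h ?_
      have : Finite (MulAction.orbit (Subgroup.zpowers β) g) :=
        Finite.of_equiv _ (MulAction.orbitZPowersEquiv β g).symm
      exact Set.toFinite _
    intro i j hij
    wlog hlt : i ≤ j generalizing i j
    · exact (this hij.symm (le_of_not_ge hlt)).symm
    by_contra hne
    have hper : Function.IsPeriodicPt (β • ·) (j - i) g := by
      rw [Function.IsPeriodicPt, Function.IsFixedPt, smul_iterate]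
      refine (β ^ i).injective ?_
      change (β ^ i) ((β ^ (j - i)) g) = (β ^ i) g
      rw [← MulAut.mul_apply, ← pow_add, Nat.add_sub_cancel' hlt]
      exact hij.symm
    have hpos : 0 < j - i := by omega
    exact (hper.minimalPeriod_pos hpos).ne' hp
  · left
    have h1 : g = x := by simpa [hx] using MulAction.mem_orbit_self (M := Subgroup.zpowers β) g
    have h2 : β g ∈ MulAction.orbit (Subgroup.zpowers β) g :=
      ⟨⟨β, Subgroup.mem_zpowers β⟩, rfl⟩
    rw [hx, ← h1] at h2
    exact h2

theorem inducedLin_lam (g : G) : inducedLin β (lam g) = lam (β g) := inducedAut_lam β g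

theorem inducedLin_pow_lam (k : ℕ) (g : G) : (inducedLin β ^ k) (lam g) = lam ((β ^ k) g) := by
  induction k with
  | zero => rfl
  | succ k ih =>
    rw [pow_succ', Module.End.mul_apply, ih, inducedLin_lam, pow_succ', MulAut.mul_apply]

theorem norm_inducedLin_le (x : reducedCStar G) : ‖inducedLin β x‖ ≤ ‖x‖ :=
  (StarAlgEquiv.norm_map (inducedAut β) x).le

theorem norm_one_reducedCStar : ‖(1 : reducedCStar G)‖ = 1 := by
  classical
  have : Nontrivial (EllTwo G) :=
    ⟨lp.single 2 (1 : G) (1 : ℂ), 0, norm_ne_zero_iff.1 (by rw [lp.norm_single] <;> simp)⟩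
  exact norm_one (α := EllTwo G →L[ℂ] EllTwo G)

/-- The fixed points form a closed star subalgebra containing the generators. -/
theorem inducedAut_eq_self_of_mem {x : reducedCStar G}
    (hx : x ∈ reducedCStarOf (fixedSubgroup β)) : inducedAut β x = x := by
  let F := StarAlgHom.equalizer (inducedAut β : reducedCStar G →⋆ₐ[ℂ] reducedCStar G)
    (StarAlgHom.id ℂ _)
  have hF : IsClosed (F : Set (reducedCStar G)) :=
    isClosed_eq (StarAlgEquiv.isometry (inducedAut β)).continuous continuous_id
  refine StarSubalgebra.topologicalClosure_minimal (t := F) (StarAlgebra.adjoin_le ?_) hF hx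
  rintro _ ⟨g, hg, rfl⟩
  exact (inducedAut_lam β g).trans (congrArg lam hg)

theorem lam_mem_reducedCStarOf {H : Subgroup G} {g : G} (hg : g ∈ H) :
    lam g ∈ reducedCStarOf H :=
  StarSubalgebra.le_topologicalClosure _ (StarAlgebra.subset_adjoin ℂ _ ⟨g, hg, rfl⟩)

theorem isClosed_reducedCStarOf (H : Subgroup G) :
    IsClosed (reducedCStarOf H : Set (reducedCStar G)) :=
  StarSubalgebra.isClosed_topologicalClosure _

theorem IsRDGroup.tendsto_cesaroMean_lam {L : GroupSeminorm G} (hRD : IsRDGroup L)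
    (hL : ∀ g, L (β g) = L g) {g : G} (hg : Function.Injective fun k : ℕ => (β ^ k) g) :
    Tendsto (fun n => cesaroMean (inducedLin β) n (lam g)) atTop (𝓝 0) := by
  have hLk (k : ℕ) : L ((β ^ k) g) = L g := by
    induction k with
    | zero => rfl
    | succ k ih => rw [pow_succ', MulAut.mul_apply, hL, ih]
  simp only [cesaroMean_apply, inducedLin_pow_lam]
  exact hRD.tendsto_mean_lam hg hLk

theorem IsRDGroup.tendsto_meanDeviation_lam {L : GroupSeminorm G} (hRD : IsRDGroup L)
    (hL : ∀ g, L (β g) = L g) {g : G} (hg : Function.Injective fun k : ℕ => (β ^ k) g)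
    {E : reducedCStar G →L[ℂ] reducedCStar G} (hE : E (lam g) = 0) (φ : reducedCStar G →L[ℂ] ℂ) :
    Tendsto (fun n => meanDeviation (inducedLin β) E φ n (lam g)) atTop (𝓝 0) := by
  have hLk (k : ℕ) : L ((β ^ k) g) = L g := by
    induction k with
    | zero => rfl
    | succ k ih => rw [pow_succ', MulAut.mul_apply, hL, ih]
  simp only [meanDeviation, inducedLin_pow_lam, hE, map_zero, sub_zero]
  exact hRD.tendsto_mean_norm_lam hg hLk φ

end Induced

end

/-! ### Assembly of the main theorem -/

theorem mainTheorem2 {G : Type*} [Group G] (L : GroupSeminorm G) (hRD : IsRDGroup L)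
    (β : MulAut G) (hL : ∀ g, L (β g) = L g)
    (horb : ∀ g : G, (MulAction.orbit (Subgroup.zpowers β) g).Infinite ∨
      ∃ x : G, MulAction.orbit (Subgroup.zpowers β) g = {x}) :
    ∃ E : reducedCStar G →L[ℂ] reducedCStar G,
      IsCondExpOnto E (reducedCStarOf (fixedSubgroup β)) ∧
      (∀ x : reducedCStar G, inducedAut β x = x ↔ x ∈ reducedCStarOf (fixedSubgroup β)) ∧
      (∀ x : reducedCStar G,
        Tendsto (fun n : ℕ => (n : ℂ)⁻¹ • ∑ k ∈ Finset.range n, (inducedLin β ^ k) x)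
          atTop (𝓝 (E x))) ∧
      IsStrictlyWeakMixing (inducedLin β) (E : reducedCStar G →ₗ[ℂ] reducedCStar G) := by
  have hβ (g : G) := MulAut.fixed_or_injective_of_orbit (horb g)
  have hT := norm_inducedLin_le (β := β)
  have hfix {g : G} (hg : β g = g) : inducedLin β (lam g) = lam g := by rw [inducedLin_lam, hg]
  obtain ⟨E, hEle, hE⟩ := exists_continuousLinearMap_tendsto_cesaroMean hT fun x => by
    induction x using reducedCStar_induction with
    | closed => exact isClosed_setOf_exists_tendsto_cesaroMean hT
    | lam_mem g =>
      rcases hβ g with hg | hg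
      · exact ⟨_, tendsto_cesaroMean_of_fixed (hfix hg)⟩
      · exact ⟨_, hRD.tendsto_cesaroMean_lam hL hg⟩
    | add x y hx hy =>
      obtain ⟨a, ha⟩ := hx
      obtain ⟨b, hb⟩ := hy
      exact ⟨a + b, by simpa only [map_add] using ha.add hb⟩
    | smul c x hx =>
      obtain ⟨a, ha⟩ := hx
      exact ⟨c • a, by simpa only [map_smul] using ha.const_smul c⟩
  have hEfix {x : reducedCStar G} (hx : inducedLin β x = x) : E x = x :=
    tendsto_nhds_unique (hE x) (tendsto_cesaroMean_of_fixed hx)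
  have hElam {g : G} (hg : Function.Injective fun k : ℕ => (β ^ k) g) : E (lam g) = 0 :=
    tendsto_nhds_unique (hE _) (hRD.tendsto_cesaroMean_lam hL hg)
  have hEmem (x : reducedCStar G) : E x ∈ reducedCStarOf (fixedSubgroup β) := by
    induction x using reducedCStar_induction with
    | closed => exact (isClosed_reducedCStarOf (fixedSubgroup β)).preimage E.continuous
    | lam_mem g =>
      rcases hβ g with hg | hg
      · rw [hEfix (hfix hg)]
        exact lam_mem_reducedCStarOf hg
      · rw [hElam hg]
        exact zero_mem _
    | add x y hx hy => rw [map_add]; exact add_mem hx hy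
    | smul c x hx => rw [map_smul]; exact SMulMemClass.smul_mem c hx
  refine ⟨E, ⟨isClosed_reducedCStarOf _, hEmem,
    fun b hb => hEfix (inducedAut_eq_self_of_mem hb), ?_⟩,
    fun x => ⟨fun hx => ?_, inducedAut_eq_self_of_mem⟩, fun x => ?_, fun φ _ x => ?_⟩
  · refine le_antisymm (E.opNorm_le_bound zero_le_one fun x => ?_) ?_
    · rw [one_mul]
      exact hEle x
    -- The unit is fixed by `α`, so `E 1 = 1` and the norm is at least one.
    · have h := E.le_opNorm 1
      rwa [hEfix (map_one (inducedAut β)), norm_one_reducedCStar, mul_one] at h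
  -- A fixed point is its own Cesàro limit, hence a value of `E`.
  · rw [← hEfix hx]
    exact hEmem x
  · simpa only [cesaroMean_apply] using hE x
  · change Tendsto (fun n => meanDeviation (inducedLin β) E φ n x) atTop (𝓝 0)
    induction x using reducedCStar_induction with
    | closed => exact isClosed_setOf_tendsto_meanDeviation hT hEle
    | lam_mem g =>
      rcases hβ g with hg | hg
      · exact tendsto_meanDeviation_of_fixed (hfix hg) (hEfix (hfix hg))
      · exact hRD.tendsto_meanDeviation_lam hL hg (hElam hg) φ
    | add x y hx hy => exact tendsto_meanDeviation_add hx hy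
    | smul c x hx => exact tendsto_meanDeviation_smul c hx
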